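/- For a positive integer $N$ let $H_N=\{(x,y)\in\mathbb{R}^2: xy\ge N,\ x,y>0\}$, let $I(H_N)=\operatorname{conv}(\mathbb{Z}^2\cap H_N)$ be its integer hull, and let $f_0(I(H_N))$ be the number of vertices (extreme points) of $I(H_N)$. Then $N^{1/3}\log N\ll f_0(I(H_N))\ll N^{1/3}\log N$. That is, there are absolute constants $c,C>0$ such that for every integer $N\ge 2$ the set $I(H_N)$ has finitely many vertices and $$c\,N^{1/3}\log N\le f_0(I(H_N))\le C\,N^{1/3}\log N .$$ -/

import Mathlib

/-- The set `H_N = {(x, y) : x y ≥ N, x, y > 0}` in the plane. -/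
def hyperbolaRegion (N : ℕ) : Set (ℝ × ℝ) :=
  {p | 0 < p.1 ∧ 0 < p.2 ∧ (N : ℝ) ≤ p.1 * p.2}

/-- The lattice `ℤ²` in the plane. -/
def integerLattice : Set (ℝ × ℝ) :=
  {p | ∃ a b : ℤ, p = ((a : ℝ), (b : ℝ))}

/-- The integer hull of a plane set: the convex hull of its lattice points. -/
def integerHull (K : Set (ℝ × ℝ)) : Set (ℝ × ℝ) :=
  convexHull ℝ (integerLattice ∩ K)

/-- The vertices of a plane convex set: its extreme points. -/
def vertexSet (P : Set (ℝ × ℝ)) : Set (ℝ × ℝ) :=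
  Set.extremePoints ℝ P

/-! ### Lattice points on the lines `q x + p y = n` -/

/-! Lower bound: for p, q > 0 the form qx + py attains its minimum over the lattice points of H_N at
a vertex (`exists_vertex_minimizer`). If p, q are coprime and 10000 (pq)^3 ≤ N, the first line past
the minimum meets H_N in a chord long compared with the lattice spacing on it. The points there
prevent two such directions from sharing a minimiser (`eq_of_common_minimizer`). So there are at
least as many vertices as coprime pairs with product at most M, where M is of order N^(1/3), and
there are ≫ M log M such pairs (`card_coprimePairs_ge`).

Upper bound: vertices with abscissa in [2^k, 2^(k+1)) form a strictly convex decreasing chain of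
width at most 2^k and height at most N / 2^k. Its edges are distinct integer vectors, which limits a
chain in a box of area N to O(N^(1/3)) vertices (`card_convex_chain_le`). There are O(log N) dyadic
blocks. -/

theorem exists_lattice_point_on_line {p q : ℤ} (hp : 0 < p) (hq : 0 < q) (h : IsCoprime p q)
    (n w : ℤ) : ∃ x y : ℤ, q * x + p * y = n ∧ w < q * x - p * y ∧ q * x - p * y ≤ w + 2 * (p * q) := by
  obtain ⟨s, t, hst⟩ := h
  have hP : 0 < 2 * (p * q) := by positivity
  set x₀ := t * n
  set y₀ := s * n
  have h0 : q * x₀ + p * y₀ = n := by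
    have : q * x₀ + p * y₀ = (s * p + t * q) * n := by simp only [x₀, y₀]; ring
    rw [this, hst, one_mul]
  set d := w + 2 * (p * q) - (q * x₀ - p * y₀)
  have h1 := Int.emod_add_mul_ediv d (2 * (p * q))
  have h2 := Int.emod_nonneg d hP.ne'
  have h3 := Int.emod_lt_of_pos d hP
  -- Translation by (p, -q) preserves the line and changes qx - py by 2pq, so every half-open window
  -- of that length is hit.
  refine ⟨x₀ + p * (d / (2 * (p * q))), y₀ - q * (d / (2 * (p * q))), ?_, ?_, ?_⟩
  · linear_combination h0
  all_goals
    have e : q * (x₀ + p * (d / (2 * (p * q)))) - p * (y₀ - q * (d / (2 * (p * q))))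
        = (q * x₀ - p * y₀) + 2 * (p * q) * (d / (2 * (p * q))) := by ring
    rw [e]
    have hd : d = w + 2 * (p * q) - (q * x₀ - p * y₀) := rfl
    linarith

/-- The identity 4pq·xy = (qx + py)² - (qx - py)² turns membership in the region into a bound on qx
- py; n > 0 excludes the negative quadrant. -/
theorem pos_of_line_coordinates {p q x y n N : ℤ} (hp : 0 < p) (hq : 0 < q) (hN : 0 < N)
    (hn : 0 < n) (hl : q * x + p * y = n)
    (hu : (q * x - p * y) ^ 2 + 4 * (p * q) * N ≤ n ^ 2) : 0 < x ∧ 0 < y ∧ N ≤ x * y := by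
  have hP : 0 < p * q := by positivity
  have hxy : N ≤ x * y := by
    have : (p * q) * N ≤ (p * q) * (x * y) := by
      subst hl
      nlinarith
    exact le_of_mul_le_mul_left this hP
  have hpos : 0 < x * y := by linarith
  rcases pos_and_pos_or_neg_and_neg_of_mul_pos hpos with h | h
  · exact ⟨h.1, h.2, hxy⟩
  · exfalso
    nlinarith [mul_neg_of_pos_of_neg hq h.1, mul_neg_of_pos_of_neg hp h.2]

/-- `(a, b)` minimises `q x + p y` among the lattice points of the hyperbola region. -/
def MinimizesAt (N p q a b : ℤ) : Prop :=
  0 < a ∧ 0 < b ∧ N ≤ a * b ∧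
    ∀ x y : ℤ, 0 < x → 0 < y → N ≤ x * y → q * a + p * b ≤ q * x + p * y

/-- The line just past the minimum of qx + py has region points at horizontal distance at least 2p
on both sides of a. Minimality for (p', q'), tested on the side where D = pq' - p'q makes it
hardest, forces 2p ≤ |D|·2p ≤ p'. With the roles exchanged this gives a contradiction. -/
theorem two_mul_le_of_common_minimizer {N p q p' q' a b : ℤ} (hN : 0 < N) (hp : 0 < p) (hq : 0 < q)
    (hpq : IsCoprime p q) (hsmall : 10000 * (p * q) ^ 3 ≤ N)
    (h : MinimizesAt N p q a b) (h' : MinimizesAt N p' q' a b) (hD : p * q' ≠ p' * q) :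
    2 * p ≤ p' := by
  obtain ⟨ha, hb, hab, hmin⟩ := h
  obtain ⟨-, -, -, hmin'⟩ := h'
  have hP : 0 < p * q := by positivity
  have hqa : 0 < q * a := by positivity
  have hpb : 0 < p * b := by positivity
  obtain ⟨P, hPdef⟩ : ∃ P, P = p * q := ⟨_, rfl⟩
  obtain ⟨m, hm⟩ : ∃ m, m = q * a + p * b := ⟨_, rfl⟩
  obtain ⟨u, hu⟩ : ∃ u, u = q * a - p * b := ⟨_, rfl⟩
  have hmu : u ^ 2 + 4 * P * N ≤ m ^ 2 := by
    rw [hm, hu, hPdef]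
    nlinarith [mul_le_mul_of_nonneg_left hab hP.le]
  rw [← hPdef] at hP hsmall
  have hm2 : 2 ≤ m := by linarith
  -- the previous line carries no lattice point of the region
  have hprev : m ^ 2 - 4 * P * N < P ^ 2 + 2 * m - 1 := by
    by_contra! hc
    obtain ⟨x, y, hl, h1, h2⟩ := exists_lattice_point_on_line hp hq hpq (m - 1) (-P)
    rw [← hPdef] at h2
    have hsq : (q * x - p * y) ^ 2 ≤ P ^ 2 := by
      rw [sq_le_sq, abs_of_pos hP, abs_le]
      constructor <;> linarith
    obtain ⟨hx, hy, hxy⟩ := pos_of_line_coordinates hp hq hN (n := m - 1) (by linarith) hl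
      (by rw [← hPdef]; nlinarith)
    have := hmin x y hx hy hxy
    linarith
  have hmP : 200 * P ^ 2 ≤ m := by
    have : (200 * P ^ 2) ^ 2 ≤ m ^ 2 := by
      nlinarith [mul_le_mul_of_nonneg_left hsmall hP.le, sq_nonneg u]
    exact le_of_sq_le_sq this (by linarith)
  -- This is (|u| + 7P)² ≤ u² + 2m + 1, so the chord on the line m + 1 extends at least 7P beyond
  -- |u| on each side. It follows from 14P|u| ≤ 98P² + u²/2 and m ≥ 200P².
  have hchord : 14 * P * |u| + 49 * P ^ 2 ≤ 2 * m + 1 := by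
    have h1 : |u| ^ 2 ≤ P ^ 2 + 2 * m := by rw [sq_abs]; linarith
    nlinarith [sq_nonneg (14 * P - |u|)]
  have hnext : ∀ x y : ℤ, q * x + p * y = m + 1 → |q * x - p * y| ≤ |u| + 7 * P →
      0 ≤ (p * q' - p' * q) * (x - a) + p' := by
    intro x y hl hxu
    have hsq : (q * x - p * y) ^ 2 ≤ (|u| + 7 * P) ^ 2 := by
      rw [sq_le_sq, abs_of_nonneg (by positivity : 0 ≤ |u| + 7 * P)]
      exact hxu
    obtain ⟨hx, hy, hxy⟩ := pos_of_line_coordinates hp hq hN (n := m + 1) (by linarith) hl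
      (by rw [← hPdef]; nlinarith [sq_abs u])
    have h1 := hmin' x y hx hy hxy
    have h2 : p * (q' * a + p' * b) ≤ p * (q' * x + p' * y) := mul_le_mul_of_nonneg_left h1 hp.le
    have h3 : p' * (q * x + p * y) = p' * (m + 1) := by rw [hl]
    rw [hm] at h3
    nlinarith
  rcases lt_or_gt_of_ne hD with hlt | hgt
  · obtain ⟨x, y, hl, h1, h2⟩ := exists_lattice_point_on_line hp hq hpq (m + 1) (u + 4 * P)
    rw [← hPdef] at h2
    have h3 := hnext x y hl (by
      rw [abs_le]; constructor <;> linarith [le_abs_self u, neg_abs_le u])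
    have h4 : 2 * p ≤ x - a := by
      have : q * (2 * p) < q * (x - a) := by linarith
      exact (lt_of_mul_lt_mul_left this hq.le).le
    nlinarith
  -- The extra -1 offsets the passage from level m to m + 1, which shifts x to the right.
  · obtain ⟨x, y, hl, h1, h2⟩ := exists_lattice_point_on_line hp hq hpq (m + 1) (u - 6 * P - 1)
    rw [← hPdef] at h2
    have h3 := hnext x y hl (by
      rw [abs_le]; constructor <;> linarith [le_abs_self u, neg_abs_le u])
    have h4 : 2 * p ≤ a - x := by
      have : q * (2 * p) ≤ q * (a - x) := by linarith
      exact le_of_mul_le_mul_left this hq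
    nlinarith

theorem eq_of_common_minimizer {N p q p' q' a b : ℤ} (hN : 0 < N) (hp : 0 < p) (hq : 0 < q)
    (hpq : IsCoprime p q) (hsmall : 10000 * (p * q) ^ 3 ≤ N) (hp' : 0 < p') (hq' : 0 < q')
    (hpq' : IsCoprime p' q') (hsmall' : 10000 * (p' * q') ^ 3 ≤ N)
    (h : MinimizesAt N p q a b) (h' : MinimizesAt N p' q' a b) : p = p' ∧ q = q' := by
  have hD : p * q' = p' * q := by
    by_contra hD
    have h1 := two_mul_le_of_common_minimizer hN hp hq hpq hsmall h h' hD
    have h2 := two_mul_le_of_common_minimizer hN hp' hq' hpq' hsmall' h' h (Ne.symm hD)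
    linarith
  have h1 : p ∣ p' := hpq.dvd_of_dvd_mul_right (Dvd.intro _ hD)
  have h2 : p' ∣ p := hpq'.dvd_of_dvd_mul_right (Dvd.intro _ hD.symm)
  have h3 : p = p' := Int.dvd_antisymm hp.le hp'.le h1 h2
  subst h3
  exact ⟨rfl, (mul_left_cancel₀ hp.ne' hD).symm⟩

/-! ### Lattice points and vertices -/

theorem mem_lattice_inter_region {N : ℕ} {a b : ℤ} :
    (((a : ℝ), (b : ℝ)) : ℝ × ℝ) ∈ integerLattice ∩ hyperbolaRegion N ↔
      0 < a ∧ 0 < b ∧ (N : ℤ) ≤ a * b := by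
  constructor
  · rintro ⟨-, h1, h2, h3⟩
    simp only at h1 h2 h3
    exact ⟨by exact_mod_cast h1, by exact_mod_cast h2, by exact_mod_cast h3⟩
  · rintro ⟨h1, h2, h3⟩
    refine ⟨⟨a, b, rfl⟩, ?_, ?_, ?_⟩
    · simpa using h1
    · simpa using h2
    · simp only
      exact_mod_cast h3

theorem mem_hull_of_int {N : ℕ} {a b : ℤ} (ha : 0 < a) (hb : 0 < b) (h : (N : ℤ) ≤ a * b) :
    (((a : ℝ), (b : ℝ)) : ℝ × ℝ) ∈ integerHull (hyperbolaRegion N) :=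
  subset_convexHull ℝ _ (mem_lattice_inter_region.2 ⟨ha, hb, h⟩)

/-- The minimum may be attained along a whole edge. Breaking ties by the smaller abscissa selects an
endpoint: the hull lies in the convex set `C`, an open half-plane with a closed boundary ray whose
endpoint is (a, b). -/
theorem exists_vertex_minimizer {N p q : ℕ} (hN : 0 < N) (hp : 0 < p) (hq : 0 < q) :
    ∃ a b : ℤ, (((a : ℝ), (b : ℝ)) : ℝ × ℝ) ∈ vertexSet (integerHull (hyperbolaRegion N)) ∧
      MinimizesAt N p q a b := by
  let S : Set (ℕ × ℕ) := {z | 0 < z.1 ∧ 0 < z.2 ∧ N ≤ z.1 * z.2}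
  have hS : S.Nonempty := ⟨(1, N), by simp [S, hN]⟩
  let f : ℕ × ℕ → ℕ ×ₗ ℕ := fun z => toLex (q * z.1 + p * z.2, z.1)
  obtain ⟨⟨a, b⟩, ⟨ha, hb, hab⟩, hmin⟩ := exists_minimalFor_of_wellFoundedLT (· ∈ S) f hS
  simp only at ha hb hab
  have hlex : ∀ x y : ℤ, 0 < x → 0 < y → (N : ℤ) ≤ x * y →
      (q : ℤ) * a + p * b < q * x + p * y ∨ ((q : ℤ) * a + p * b = q * x + p * y ∧ (a : ℤ) ≤ x) := by
    intro x y hx hy hxy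
    lift x to ℕ using hx.le
    lift y to ℕ using hy.le
    have hz : ((x, y) : ℕ × ℕ) ∈ S := ⟨by exact_mod_cast hx, by exact_mod_cast hy, by exact_mod_cast hxy⟩
    have hle : f (a, b) ≤ f (x, y) := by
      rcases le_total (f (a, b)) (f (x, y)) with h | h
      · exact h
      · exact hmin hz h
    rw [Prod.Lex.toLex_le_toLex] at hle
    simp only at hle
    exact_mod_cast hle
  refine ⟨a, b, ?_, by exact_mod_cast ha, by exact_mod_cast hb, by exact_mod_cast hab, ?_⟩
  swap
  · intro x y hx hy hxy
    rcases hlex x y hx hy hxy with h | h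
    · exact h.le
    · exact h.1.le
  have hq' : (0 : ℝ) < q := by exact_mod_cast hq
  have hp' : (0 : ℝ) < p := by exact_mod_cast hp
  let C : Set (ℝ × ℝ) := {z | (q : ℝ) * a + p * b < q * z.1 + p * z.2 ∨
    ((q : ℝ) * a + p * b = q * z.1 + p * z.2 ∧ (a : ℝ) ≤ z.1)}
  have hC : Convex ℝ C := by
    rintro ⟨x₁, y₁⟩ h1 ⟨x₂, y₂⟩ h2 s t hs ht hst
    simp only [C, Set.mem_ofPred_eq, Prod.fst_add, Prod.smul_fst, Prod.snd_add, Prod.smul_snd,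
      smul_eq_mul] at h1 h2 ⊢
    have e : (q : ℝ) * (s * x₁ + t * x₂) + p * (s * y₁ + t * y₂)
        = s * (q * x₁ + p * y₁) + t * (q * x₂ + p * y₂) := by ring
    rw [e]
    generalize (q : ℝ) * a + p * b = m at *
    generalize (q : ℝ) * x₁ + p * y₁ = m₁ at *
    generalize (q : ℝ) * x₂ + p * y₂ = m₂ at *
    obtain rfl : s = 1 - t := by linarith
    rcases hs.eq_or_lt with h0 | h0
    · obtain rfl : t = 1 := by linarith
      simpa using h2
    rcases ht.eq_or_lt with h0' | h0'
    · subst h0'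
      simpa using h1
    rcases h1 with h1 | ⟨h1, h1'⟩ <;> rcases h2 with h2 | ⟨h2, h2'⟩
    · left; nlinarith [mul_lt_mul_of_pos_left h1 h0, mul_lt_mul_of_pos_left h2 h0']
    · left; nlinarith [mul_lt_mul_of_pos_left h1 h0]
    · left; nlinarith [mul_lt_mul_of_pos_left h2 h0']
    · right
      constructor
      · rw [← h1, ← h2]; ring
      · nlinarith
  have hsub : integerHull (hyperbolaRegion N) ⊆ C := by
    refine convexHull_min ?_ hC
    rintro z ⟨⟨x, y, rfl⟩, hz⟩
    obtain ⟨hx, hy, hxy⟩ := mem_lattice_inter_region.1 ⟨⟨x, y, rfl⟩, hz⟩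
    have := hlex x y hx hy hxy
    simp only [C, Set.mem_ofPred_eq]
    exact_mod_cast this
  rw [vertexSet, mem_extremePoints_iff_left]
  refine ⟨mem_hull_of_int (by exact_mod_cast ha) (by exact_mod_cast hb) (by exact_mod_cast hab), ?_⟩
  rintro ⟨x₁, y₁⟩ h1 ⟨x₂, y₂⟩ h2 ⟨s, t, hs, ht, hst, he⟩
  have h1 := hsub h1
  have h2 := hsub h2
  simp only [C, Set.mem_ofPred_eq] at h1 h2
  simp only [Prod.smul_mk, smul_eq_mul, Prod.mk_add_mk, Prod.mk.injEq, Int.cast_natCast] at he ⊢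
  obtain ⟨hea, heb⟩ := he
  have e : s * (q * x₁ + p * y₁) + t * (q * x₂ + p * y₂) = (q : ℝ) * a + p * b := by
    rw [← hea, ← heb]; ring
  obtain rfl : s = 1 - t := by linarith
  have k1 : (q : ℝ) * a + p * b = q * x₁ + p * y₁ := by
    rcases h1 with h1 | h1
    · exfalso
      have h2' : (q : ℝ) * a + p * b ≤ q * x₂ + p * y₂ := by
        rcases h2 with h | h
        · exact h.le
        · exact h.1.le
      nlinarith [mul_lt_mul_of_pos_left h1 hs, mul_le_mul_of_nonneg_left h2' ht.le]
    · exact h1.1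
  have k2 : (q : ℝ) * a + p * b = q * x₂ + p * y₂ := by
    rcases h2 with h2 | h2
    · exfalso
      nlinarith [mul_lt_mul_of_pos_left h2 ht]
    · exact h2.1
  have l1 : (a : ℝ) ≤ x₁ := by
    rcases h1 with h | h
    · linarith
    · exact h.2
  have l2 : (a : ℝ) ≤ x₂ := by
    rcases h2 with h | h
    · linarith
    · exact h.2
  have l3 : x₁ = a := by
    refine le_antisymm ?_ l1
    by_contra! hc
    nlinarith [mul_lt_mul_of_pos_left hc hs, mul_le_mul_of_nonneg_left l2 ht.le]
  refine ⟨l3, ?_⟩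
  rw [l3] at k1
  have : (p : ℝ) * y₁ = p * b := by linarith
  exact mul_left_cancel₀ hp'.ne' this

/-! ### Necessary conditions for vertices -/

/-- If the left or lower lattice neighbour were in the region, the vertex would be the midpoint of
it and the opposite neighbour. -/
theorem vertex_coordinates {N : ℕ} (hN : 0 < N) {v : ℝ × ℝ}
    (hv : v ∈ vertexSet (integerHull (hyperbolaRegion N))) :
    ∃ a b : ℤ, v = ((a : ℝ), (b : ℝ)) ∧ 0 < a ∧ 0 < b ∧ (N : ℤ) ≤ a * b ∧
      (a - 1) * b < N ∧ a * (b - 1) < N := by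
  have hS := extremePoints_convexHull_subset hv
  obtain ⟨a, b, rfl⟩ := hS.1
  obtain ⟨ha, hb, hab⟩ := mem_lattice_inter_region.1 hS
  have hN' : (0 : ℤ) < N := by exact_mod_cast hN
  rw [vertexSet, mem_extremePoints_iff_left] at hv
  refine ⟨a, b, rfl, ha, hb, hab, ?_, ?_⟩
  · by_contra! hc
    have hpos : 0 < a - 1 := by
      by_contra! h
      nlinarith
    have := hv.2 _ (mem_hull_of_int hpos hb hc) _
      (mem_hull_of_int (a := a + 1) (b := b) (by linarith) hb (by nlinarith))
      ⟨1 / 2, 1 / 2, by norm_num, by norm_num, by norm_num, by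
        ext <;> simp <;> ring⟩
    simp at this
  · by_contra! hc
    have hpos : 0 < b - 1 := by
      by_contra! h
      nlinarith
    have := hv.2 _ (mem_hull_of_int ha hpos hc) _
      (mem_hull_of_int (a := a) (b := b + 1) ha (by linarith) (by nlinarith))
      ⟨1 / 2, 1 / 2, by norm_num, by norm_num, by norm_num, by
        ext <;> simp <;> ring⟩
    simp at this

/-- A vertex on the chord contradicts extremality directly; one above it lies strictly between the
chord point below and the lattice point one unit higher. The outer points need only lie in the hull.
-/
theorem vertex_below_chord {N : ℕ} {a₁ b₁ a₂ b₂ a₃ b₃ : ℤ}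
    (h₁ : (((a₁ : ℝ), (b₁ : ℝ)) : ℝ × ℝ) ∈ integerHull (hyperbolaRegion N))
    (h₂ : (((a₂ : ℝ), (b₂ : ℝ)) : ℝ × ℝ) ∈ vertexSet (integerHull (hyperbolaRegion N)))
    (h₃ : (((a₃ : ℝ), (b₃ : ℝ)) : ℝ × ℝ) ∈ integerHull (hyperbolaRegion N))
    (h12 : a₁ < a₂) (h23 : a₂ < a₃) :
    (a₃ - a₁) * b₂ < (a₃ - a₂) * b₁ + (a₂ - a₁) * b₃ := by
  have hS := extremePoints_convexHull_subset h₂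
  obtain ⟨ha, hb, hab⟩ := mem_lattice_inter_region.1 hS
  rw [vertexSet, mem_extremePoints_iff_left] at h₂
  by_contra! hc
  have h12' : (0 : ℝ) < a₂ - a₁ := by rw [sub_pos]; exact_mod_cast h12
  have h23' : (0 : ℝ) < a₃ - a₂ := by rw [sub_pos]; exact_mod_cast h23
  have h13' : (0 : ℝ) < a₃ - a₁ := by linarith
  have hc' : ((a₃ : ℝ) - a₂) * b₁ + (a₂ - a₁) * b₃ ≤ (a₃ - a₁) * b₂ := by exact_mod_cast hc
  let yc : ℝ := (((a₃ : ℝ) - a₂) * b₁ + (a₂ - a₁) * b₃) / (a₃ - a₁)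
  have hmem : (((a₂ : ℝ), yc) : ℝ × ℝ) ∈ openSegment ℝ (((a₁ : ℝ), (b₁ : ℝ)) : ℝ × ℝ) ((a₃ : ℝ), (b₃ : ℝ)) := by
    refine ⟨(a₃ - a₂) / (a₃ - a₁), (a₂ - a₁) / (a₃ - a₁), by positivity, by positivity, by field_simp; ring, ?_⟩
    ext
    · simp; field_simp; ring
    · simp [yc]; field_simp
  have hyc : yc ≤ b₂ := by
    rw [div_le_iff₀ h13']; linarith
  rcases hyc.eq_or_lt with h | h
  · rw [h] at hmem
    have := h₂.2 _ h₁ _ h₃ hmem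
    simp only [Prod.mk.injEq] at this
    linarith [this.1]
  · have hcm : (((a₂ : ℝ), yc) : ℝ × ℝ) ∈ integerHull (hyperbolaRegion N) :=
      (convex_convexHull ℝ _).openSegment_subset h₁ h₃ hmem
    have hd : 0 < (b₂ : ℝ) + 1 - yc := by linarith
    have := h₂.2 _ hcm _
      (mem_hull_of_int (a := a₂) (b := b₂ + 1) ha (by linarith) (by nlinarith))
      ⟨1 / (b₂ + 1 - yc), (b₂ - yc) / (b₂ + 1 - yc), by positivity,
        div_pos (by linarith) hd, by field_simp; ring, by
        ext
        · simp; field_simp; ring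
        · simp; field_simp; ring⟩
    simp only [Prod.mk.injEq] at this
    linarith [this.2]

/-! ### Counting coprime pairs -/

theorem sum_inv_sq_le (n : ℕ) : ∑ d ∈ Finset.Icc 2 n, (1 : ℝ) / (d : ℝ) ^ 2 ≤ 3 / 4 := by
  rcases lt_or_ge n 2 with h | h
  · rw [Finset.Icc_eq_empty_of_lt h]; norm_num
  have : ∑ d ∈ Finset.Icc 2 n, (1 : ℝ) / (d : ℝ) ^ 2 ≤ 3 / 4 - 1 / n := by
    induction n, h using Nat.le_induction with
    | base => norm_num
    | succ n hn ih =>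
      rw [Finset.sum_Icc_succ_top (by omega)]
      -- Telescoping comparison 1/(n+1)² ≤ 1/n - 1/(n+1).
      have hn0 : (0 : ℝ) < n := by exact_mod_cast (by omega : 0 < n)
      have : (1 : ℝ) / ((n + 1 : ℕ) : ℝ) ^ 2 ≤ 1 / n - 1 / ((n + 1 : ℕ) : ℝ) := by
        push_cast
        rw [div_sub_div _ _ hn0.ne' (by positivity), div_le_div_iff₀ (by positivity) (by positivity)]
        nlinarith
      linarith
  have h0 : (0 : ℝ) ≤ 1 / n := by positivity
  linarith

/-- At least a quarter of the pairs in `[1, P] × [1, Q]` are coprime. -/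
theorem card_coprime_ge (P Q : ℕ) :
    P * Q ≤ 4 * ((Finset.Ioc 0 P ×ˢ Finset.Ioc 0 Q).filter (fun z => z.1.Coprime z.2)).card := by
  set B := Finset.Ioc 0 P ×ˢ Finset.Ioc 0 Q
  have hB : B.card = P * Q := by simp [B]
  -- A non-coprime pair is filed under its gcd d ≥ 2; class d has at most PQ/d² pairs.
  have hsub : B.filter (fun z => ¬ z.1.Coprime z.2) ⊆ (Finset.Icc 2 P).biUnion (fun d =>
      (Finset.Ioc 0 P).filter (fun x => d ∣ x) ×ˢ (Finset.Ioc 0 Q).filter (fun x => d ∣ x)) := by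
    rintro ⟨p, q⟩ hz
    simp only [B, Finset.mem_filter, Finset.mem_product, Finset.mem_Ioc] at hz
    obtain ⟨⟨⟨hp, hpP⟩, hq, hqQ⟩, hc⟩ := hz
    simp only [Finset.mem_biUnion, Finset.mem_product, Finset.mem_filter, Finset.mem_Ioc,
      Finset.mem_Icc]
    have hg : 0 < Nat.gcd p q := Nat.gcd_pos_of_pos_left _ hp
    have hg1 : Nat.gcd p q ≠ 1 := hc
    exact ⟨Nat.gcd p q, ⟨by omega, (Nat.gcd_le_left _ hp).trans hpP⟩,
      ⟨⟨hp, hpP⟩, Nat.gcd_dvd_left _ _⟩, ⟨hq, hqQ⟩, Nat.gcd_dvd_right _ _⟩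
  have hbad : ((B.filter (fun z => ¬ z.1.Coprime z.2)).card : ℝ) ≤ 3 / 4 * (P * Q) := by
    calc ((B.filter (fun z => ¬ z.1.Coprime z.2)).card : ℝ)
        ≤ ∑ d ∈ Finset.Icc 2 P, (((P / d) * (Q / d) : ℕ) : ℝ) := by
          have := (Finset.card_le_card hsub).trans Finset.card_biUnion_le
          simp only [Finset.card_product, Nat.Ioc_filter_dvd_card_eq_div] at this
          exact_mod_cast this
      _ ≤ ∑ d ∈ Finset.Icc 2 P, (P * Q : ℝ) * (1 / (d : ℝ) ^ 2) := by
          refine Finset.sum_le_sum fun d _ => ?_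
          push_cast
          calc ((P / d : ℕ) : ℝ) * ((Q / d : ℕ) : ℝ) ≤ (P / d : ℝ) * (Q / d : ℝ) := by
                gcongr <;> exact Nat.cast_div_le
            _ = _ := by ring
      _ = (P * Q : ℝ) * ∑ d ∈ Finset.Icc 2 P, 1 / (d : ℝ) ^ 2 := by rw [Finset.mul_sum]
      _ ≤ _ := by
          have := mul_le_mul_of_nonneg_left (sum_inv_sq_le P) (by positivity : (0 : ℝ) ≤ P * Q)
          linarith
  have hsum := Finset.card_filter_add_card_filter_not (s := B) (fun z => z.1.Coprime z.2)
  rw [hB] at hsum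
  have hsum' : ((B.filter (fun z => z.1.Coprime z.2)).card : ℝ)
      + ((B.filter (fun z => ¬ z.1.Coprime z.2)).card : ℝ) = P * Q := by exact_mod_cast hsum
  have : (P * Q : ℝ) ≤ 4 * ((B.filter (fun z => z.1.Coprime z.2)).card : ℝ) := by linarith
  exact_mod_cast this

/-- Coprime pairs of the box `(16 ^ i / 16, 16 ^ i] × (16 ^ j / 16, 16 ^ j]`. -/
def coprimeBox (i j : ℕ) : Finset (ℕ × ℕ) :=
  (Finset.Ioc (16 ^ i / 16) (16 ^ i) ×ˢ Finset.Ioc (16 ^ j / 16) (16 ^ j)).filter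
    (fun z => z.1.Coprime z.2)

/-- Of the at least 1/4 of coprime pairs in the full box, the two discarded strips remove at most
1/16 each, leaving 1/8. -/
theorem card_coprimeBox_ge (i j : ℕ) : 16 ^ (i + j) ≤ 8 * (coprimeBox i j).card := by
  have h := card_coprime_ge (16 ^ i) (16 ^ j)
  rw [pow_add]
  generalize hP : 16 ^ i = P at *
  generalize hQ : 16 ^ j = Q at *
  have hsub : (Finset.Ioc 0 P ×ˢ Finset.Ioc 0 Q).filter (fun z => z.1.Coprime z.2) ⊆
      coprimeBox i j ∪ (Finset.Ioc 0 (P / 16) ×ˢ Finset.Ioc 0 Q ∪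
        Finset.Ioc 0 P ×ˢ Finset.Ioc 0 (Q / 16)) := by
    rintro ⟨p, q⟩ hz
    simp only [coprimeBox, hP, hQ, Finset.mem_union, Finset.mem_filter, Finset.mem_product,
      Finset.mem_Ioc] at hz ⊢
    obtain ⟨hz, hc⟩ := hz
    by_cases h1 : p ≤ P / 16
    · right; left; omega
    by_cases h2 : q ≤ Q / 16
    · right; right; omega
    · left; refine ⟨?_, hc⟩; omega
  have hcard := (Finset.card_le_card hsub).trans
    ((Finset.card_union_le _ _).trans (add_le_add_right (Finset.card_union_le _ _) _))
  simp only [Finset.card_product, Nat.card_Ioc, Nat.sub_zero] at hcard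
  have h1 : 16 * (P / 16 * Q) ≤ P * Q := by
    rw [← mul_assoc]; exact Nat.mul_le_mul_right _ (Nat.mul_div_le _ _)
  have h2 : 16 * (P * (Q / 16)) ≤ P * Q := by
    rw [mul_left_comm]; exact Nat.mul_le_mul_left _ (Nat.mul_div_le _ _)
  omega

/-- Coprime pairs of positive integers with product at most `M`. -/
def coprimePairs (M : ℕ) : Finset (ℕ × ℕ) :=
  (Finset.Ioc 0 M ×ˢ Finset.Ioc 0 M).filter (fun z => z.1.Coprime z.2 ∧ z.1 * z.2 ≤ M)

theorem card_coprimePairs_ge (k : ℕ) : (k + 1) * 16 ^ k ≤ 8 * (coprimePairs (16 ^ k)).card := by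
  -- The k + 1 boxes along i + j = k are disjoint and each contributes order 16^k; this is the
  -- source of the logarithm.
  have hsub : (Finset.range (k + 1)).biUnion (fun i => coprimeBox i (k - i)) ⊆
      coprimePairs (16 ^ k) := by
    rintro ⟨p, q⟩ hz
    simp only [coprimeBox, coprimePairs, Finset.mem_biUnion, Finset.mem_filter, Finset.mem_product,
      Finset.mem_Ioc, Finset.mem_range] at hz ⊢
    obtain ⟨i, hi, ⟨⟨hp, hp'⟩, hq, hq'⟩, hc⟩ := hz
    refine ⟨⟨⟨by omega, hp'.trans (Nat.pow_le_pow_right (by norm_num) (by omega))⟩, by omega,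
      hq'.trans (Nat.pow_le_pow_right (by norm_num) (by omega))⟩, hc, ?_⟩
    calc p * q ≤ 16 ^ i * 16 ^ (k - i) := Nat.mul_le_mul hp' hq'
      _ = 16 ^ k := by rw [← pow_add]; congr 1; omega
  have hlt : ∀ i j : ℕ, i < j → ∀ a b, Disjoint (coprimeBox i a) (coprimeBox j b) := by
    intro i j hij a b
    rw [Finset.disjoint_left]
    rintro ⟨p, q⟩ h1 h2
    simp only [coprimeBox, Finset.mem_filter, Finset.mem_product, Finset.mem_Ioc] at h1 h2
    obtain ⟨j, rfl⟩ : ∃ l, j = l + 1 := ⟨j - 1, by omega⟩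
    have := Nat.pow_le_pow_right (show 0 < 16 by norm_num) (Nat.lt_succ_iff.1 hij)
    rw [pow_succ, Nat.mul_div_cancel _ (by norm_num)] at h2
    omega
  have hdisj : ∀ i ∈ Finset.range (k + 1), ∀ j ∈ Finset.range (k + 1), i ≠ j →
      Disjoint (coprimeBox i (k - i)) (coprimeBox j (k - j)) := by
    intro i _ j _ hij
    rcases lt_or_gt_of_ne hij with h | h
    · exact hlt i j h _ _
    · exact (hlt j i h _ _).symm
  have hcard := Finset.card_le_card hsub
  rw [Finset.card_biUnion hdisj] at hcard
  calc (k + 1) * 16 ^ k = ∑ i ∈ Finset.range (k + 1), 16 ^ k := by simp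
    _ ≤ ∑ i ∈ Finset.range (k + 1), 8 * (coprimeBox i (k - i)).card := by
        refine Finset.sum_le_sum fun i hi => ?_
        have := card_coprimeBox_ge i (k - i)
        rwa [show i + (k - i) = k by have := Finset.mem_range.1 hi; omega] at this
    _ ≤ _ := by rw [← Finset.mul_sum]; exact Nat.mul_le_mul_left _ hcard

/-! ### Lower bound -/

theorem card_coprimePairs_le_ncard {N M : ℕ} (hN : 0 < N) (hM : 10000 * M ^ 3 ≤ N)
    (hfin : (vertexSet (integerHull (hyperbolaRegion N))).Finite) :
    (coprimePairs M).card ≤ (vertexSet (integerHull (hyperbolaRegion N))).ncard := by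
  have hex : ∀ z ∈ coprimePairs M, ∃ v ∈ vertexSet (integerHull (hyperbolaRegion N)),
      ∃ a b : ℤ, v = ((a : ℝ), (b : ℝ)) ∧ MinimizesAt N z.1 z.2 a b := by
    intro z hz
    simp only [coprimePairs, Finset.mem_filter, Finset.mem_product, Finset.mem_Ioc] at hz
    obtain ⟨a, b, hv, hmin⟩ := exists_vertex_minimizer hN hz.1.1.1 hz.1.2.1
    exact ⟨_, hv, a, b, rfl, hmin⟩
  choose! f hfV a b hfab hmin using hex
  rw [Set.ncard_eq_toFinset_card _ hfin]
  refine Finset.card_le_card_of_injOn f (fun z hz => by simpa using hfV z hz) ?_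
  intro z hz w hw hzw
  have hmz := hmin z hz
  have hmw := hmin w hw
  rw [hfab z hz, hfab w hw] at hzw
  simp only [Prod.mk.injEq, Int.cast_inj] at hzw
  rw [← hzw.1, ← hzw.2] at hmw
  have key : ∀ z ∈ coprimePairs M, 0 < (z.1 : ℤ) ∧ 0 < (z.2 : ℤ) ∧ IsCoprime (z.1 : ℤ) z.2 ∧
      10000 * ((z.1 : ℤ) * z.2) ^ 3 ≤ N := by
    intro z hz
    simp only [coprimePairs, Finset.mem_filter, Finset.mem_product, Finset.mem_Ioc] at hz
    refine ⟨by exact_mod_cast hz.1.1.1, by exact_mod_cast hz.1.2.1,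
      Nat.isCoprime_iff_coprime.2 hz.2.1, ?_⟩
    have := (Nat.mul_le_mul_left 10000 (Nat.pow_le_pow_left hz.2.2 3)).trans hM
    exact_mod_cast this
  obtain ⟨h1, h2, h3, h4⟩ := key z hz
  obtain ⟨k1, k2, k3, k4⟩ := key w hw
  obtain ⟨e1, e2⟩ := eq_of_common_minimizer (by exact_mod_cast hN) h1 h2 h3 h4 k1 k2 k3 k4 hmz hmw
  exact Prod.ext (by exact_mod_cast e1) (by exact_mod_cast e2)

theorem log_10000_le : Real.log 10000 ≤ 18 := by
  have h2 := Real.log_two_lt_d9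
  have : Real.log 10000 ≤ Real.log (2 ^ 14) := Real.log_le_log (by norm_num) (by norm_num)
  rw [Real.log_pow] at this
  push_cast at this
  linarith

theorem rpow_third_le {N x : ℝ} (hN : 0 ≤ N) (hx : 0 ≤ x) (h : N ≤ x ^ 3) :
    N ^ (1 / 3 : ℝ) ≤ x := by
  calc N ^ (1 / 3 : ℝ) ≤ (x ^ 3) ^ (1 / 3 : ℝ) := Real.rpow_le_rpow hN h (by norm_num)
    _ = x := by
      rw [← Real.rpow_natCast, ← Real.rpow_mul hx]; norm_num

theorem ncard_vertices_ge {N : ℕ} (hN : 2 ≤ N)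
    (hfin : (vertexSet (integerHull (hyperbolaRegion N))).Finite) :
    (N : ℝ) ^ (1 / 3 : ℝ) * Real.log N ≤
      76032 * ((vertexSet (integerHull (hyperbolaRegion N))).ncard : ℝ) := by
  have hN1 : (1 : ℝ) ≤ N := by exact_mod_cast (by omega : 1 ≤ N)
  have hlog : 0 ≤ Real.log N := Real.log_nonneg hN1
  -- For small N a single vertex suffices; otherwise k is the largest exponent with 10000·(16^k)³ ≤
  -- N.
  rcases lt_or_ge N 10000 with h | h
  · have hpos : 1 ≤ (vertexSet (integerHull (hyperbolaRegion N))).ncard := by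
      obtain ⟨a, b, hv, -⟩ := exists_vertex_minimizer (N := N) (by omega) one_pos one_pos
      exact (Set.ncard_pos hfin).2 ⟨_, hv⟩
    have hpos' : (1 : ℝ) ≤ ((vertexSet (integerHull (hyperbolaRegion N))).ncard : ℝ) := by
      exact_mod_cast hpos
    have hN' : (N : ℝ) ≤ 10000 := by exact_mod_cast h.le
    have h1 : (N : ℝ) ^ (1 / 3 : ℝ) ≤ 22 :=
      rpow_third_le (by linarith) (by norm_num) (by linarith)
    have h2 : Real.log N ≤ 18 := (Real.log_le_log (by linarith) hN').trans log_10000_le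
    calc (N : ℝ) ^ (1 / 3 : ℝ) * Real.log N ≤ 22 * 18 := by gcongr
      _ ≤ _ := by linarith
  · obtain ⟨k, hk⟩ : ∃ k, k = Nat.log 4096 (N / 10000) := ⟨_, rfl⟩
    have hk1 : 4096 ^ k ≤ N / 10000 := by
      rw [hk]; exact Nat.pow_log_le_self _ (by omega)
    have hk2 : N / 10000 < 4096 ^ (k + 1) := by
      rw [hk]; exact Nat.lt_pow_succ_log_self (by norm_num) _
    have hM : 10000 * (16 ^ k) ^ 3 ≤ N := by
      rw [← pow_mul, mul_comm k 3, pow_mul]; norm_num; omega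
    have hNlt : N ≤ 10000 * 4096 ^ (k + 1) := by omega
    have hcard := (card_coprimePairs_ge k).trans
      (Nat.mul_le_mul_left 8 (card_coprimePairs_le_ncard (by omega) hM hfin))
    have hcard' : ((k : ℝ) + 1) * 16 ^ k ≤
      8 * ((vertexSet (integerHull (hyperbolaRegion N))).ncard : ℝ) := by exact_mod_cast hcard
    have hN' : (N : ℝ) ≤ 10000 * 4096 ^ (k + 1) := by exact_mod_cast hNlt
    -- 352 = 22·16, with 22³ ≥ 10000 and 16³ = 4096.
    have h1 : (N : ℝ) ^ (1 / 3 : ℝ) ≤ 352 * 16 ^ k := by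
      refine rpow_third_le (by linarith) (by positivity) (hN'.trans ?_)
      have e : ((352 : ℝ) * 16 ^ k) ^ 3 = 352 ^ 3 * 4096 ^ k := by
        rw [mul_pow, ← pow_mul, mul_comm k 3, pow_mul]; norm_num
      rw [e, pow_succ]
      have : (0 : ℝ) < 4096 ^ k := by positivity
      linarith
    have h2 : Real.log N ≤ 27 * (k + 1) := by
      have := Real.log_le_log (by linarith) hN'
      rw [Real.log_mul (by norm_num) (by positivity), Real.log_pow,
        show (4096 : ℝ) = 2 ^ 12 by norm_num, Real.log_pow] at this
      push_cast at this
      have hk0 : (0 : ℝ) ≤ k := by positivity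
      nlinarith [log_10000_le, Real.log_two_lt_d9]
    calc (N : ℝ) ^ (1 / 3 : ℝ) * Real.log N ≤ (352 * 16 ^ k) * (27 * (k + 1)) := by gcongr
      _ = 9504 * (((k : ℝ) + 1) * 16 ^ k) := by ring
      _ ≤ _ := by linarith

/-! ### Upper bound -/

theorem card_large_increments_le {n : ℕ} {f : ℕ → ℤ} {X t : ℝ} (hX : 0 < X) (ht : 0 < t)
    (hpos : ∀ i < n, f i < f (i + 1)) (hsum : (f n : ℝ) - f 0 ≤ X) :
    (((Finset.range n).filter (fun i => t * X < (f (i + 1) : ℝ) - f i)).card : ℝ) ≤ 1 / t := by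
  set F := (Finset.range n).filter (fun i => t * X < (f (i + 1) : ℝ) - f i)
  have h1 : (F.card : ℝ) * (t * X) ≤ ∑ i ∈ F, ((f (i + 1) : ℝ) - f i) := by
    rw [← nsmul_eq_mul]
    exact Finset.card_nsmul_le_sum _ _ _ fun i hi => (Finset.mem_filter.1 hi).2.le
  have h2 : ∑ i ∈ F, ((f (i + 1) : ℝ) - f i) ≤ ∑ i ∈ Finset.range n, ((f (i + 1) : ℝ) - f i) := by
    refine Finset.sum_le_sum_of_subset_of_nonneg (Finset.filter_subset _ _) fun i hi _ => ?_
    have := hpos i (Finset.mem_range.1 hi)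
    rw [sub_nonneg]
    exact_mod_cast this.le
  rw [Finset.sum_range_sub (fun i => (f i : ℝ))] at h2
  rw [le_div_iff₀ ht]
  have : (F.card * t) * X ≤ 1 * X := by linarith
  exact le_of_mul_le_mul_right this hX

/-- A strictly convex decreasing lattice chain of width `X` and height `Y` is short. -/
theorem card_convex_chain_le (A : Finset ℤ) (y : ℤ → ℤ) {X Y t : ℝ} (hX : 0 < X) (hY : 0 < Y)
    (ht : 0 < t)
    (hanti : ∀ a ∈ A, ∀ b ∈ A, a < b → y b < y a)
    (hconv : ∀ a₁ ∈ A, ∀ a₂ ∈ A, ∀ a₃ ∈ A, a₁ < a₂ → a₂ < a₃ →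
      (a₃ - a₁) * y a₂ < (a₃ - a₂) * y a₁ + (a₂ - a₁) * y a₃)
    (hAX : ∀ a ∈ A, ∀ b ∈ A, (b : ℝ) - a ≤ X)
    (hAY : ∀ a ∈ A, ∀ b ∈ A, (y a : ℝ) - y b ≤ Y) :
    (A.card : ℝ) ≤ 1 + 2 / t + t ^ 2 * (X * Y) := by
  rcases Nat.eq_zero_or_pos A.card with h0 | h0
  · rw [h0]; push_cast; positivity
  obtain ⟨n, hn⟩ : ∃ n, A.card = n + 1 := ⟨A.card - 1, by omega⟩
  obtain ⟨g, hgA, hgm⟩ : ∃ g : ℕ → ℤ, (∀ i ≤ n, g i ∈ A) ∧ ∀ i j, i < j → j ≤ n → g i < g j := by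
    -- Increasing enumeration of `A`; the value 0 past n is never used.
    refine ⟨fun i => if h : i < n + 1 then A.orderEmbOfFin hn ⟨i, h⟩ else 0, ?_, ?_⟩
    · intro i hi
      simp only [Nat.lt_succ_iff.2 hi, dif_pos]
      exact Finset.orderEmbOfFin_mem _ _ _
    · intro i j hij hj
      simp only [Nat.lt_succ_iff.2 hj, Nat.lt_succ_iff.2 (hij.le.trans hj), dif_pos]
      exact (A.orderEmbOfFin hn).strictMono hij
  have hlarge1 := card_large_increments_le (n := n) (f := g) hX ht
    (fun i hi => hgm i (i + 1) (by omega) hi) (hAX _ (hgA 0 (by omega)) _ (hgA n le_rfl))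
  have hstep : ∀ i < n, y (g (i + 1)) < y (g i) := fun i hi =>
    hanti _ (hgA i hi.le) _ (hgA (i + 1) hi) (hgm i (i + 1) (by omega) hi)
  have hlarge2 := card_large_increments_le (n := n) (f := fun i => - y (g i)) hY ht
    (fun i hi => neg_lt_neg (hstep i hi)) (by
      have := hAY _ (hgA 0 (by omega)) _ (hgA n le_rfl)
      push_cast; linarith)
  set F₁ := (Finset.range n).filter (fun i => t * X < (g (i + 1) : ℝ) - g i)
  set F₂ := (Finset.range n).filter
    (fun i => t * Y < ((-y (g (i + 1)) : ℤ) : ℝ) - ((-y (g i) : ℤ) : ℝ))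
  set F₃ := (Finset.range n).filter
    (fun i => (g (i + 1) : ℝ) - g i ≤ t * X ∧ (y (g i) : ℝ) - y (g (i + 1)) ≤ t * Y)
  -- Each edge is wide (at most 1/t), tall (at most 1/t), or an integer vector in a tX by tY box.
  have hsub : Finset.range n ⊆ F₁ ∪ (F₂ ∪ F₃) := by
    intro i hi
    simp only [F₁, F₂, F₃, Finset.mem_union, Finset.mem_filter, hi, true_and]
    push_cast
    by_cases h1 : t * X < (g (i + 1) : ℝ) - g i
    · exact Or.inl h1
    by_cases h2 : t * Y < (y (g i) : ℝ) - y (g (i + 1))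
    · right; left; linarith
    · right; right; exact ⟨not_lt.1 h1, not_lt.1 h2⟩
  -- Equal edge vectors would give three collinear points, or a parallelogram whose diagonals share
  -- a midpoint although two opposite vertices lie strictly below the diagonal joining the others.
  have hinj : ∀ i j, i < j → j < n → g (i + 1) - g i = g (j + 1) - g j →
      y (g i) - y (g (i + 1)) = y (g j) - y (g (j + 1)) → False := by
    intro i j hij hj e1 e2
    have m1 := hgA i (by omega)
    have m2 := hgA (i + 1) (by omega)
    have m3 := hgA j (by omega)
    have m4 := hgA (j + 1) (by omega)
    have l1 := hgm i (i + 1) (by omega) (by omega)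
    have l3 := hgm j (j + 1) (by omega) (by omega)
    rcases (Nat.succ_le_of_lt hij).eq_or_lt with h | h
    · rw [Nat.succ_eq_add_one] at h
      subst h
      have := hconv _ m1 _ m3 _ m4 l1 l3
      generalize g i = x₁ at *
      generalize g (i + 1) = x₂ at *
      generalize g (i + 1 + 1) = x₃ at *
      obtain rfl : x₃ = 2 * x₂ - x₁ := by linarith
      obtain h3 : y (2 * x₂ - x₁) = 2 * y x₂ - y x₁ := by linarith
      rw [h3] at this
      nlinarith
    · have l2 := hgm (i + 1) j h (by omega)
      have c1 := hconv _ m1 _ m2 _ m4 l1 (l2.trans l3)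
      have c2 := hconv _ m1 _ m3 _ m4 (l1.trans l2) l3
      generalize g i = x₁ at *
      generalize g (i + 1) = x₂ at *
      generalize g j = x₃ at *
      generalize g (j + 1) = x₄ at *
      generalize y x₁ = y₁ at *
      generalize y x₂ = y₂ at *
      generalize y x₃ = y₃ at *
      generalize y x₄ = y₄ at *
      obtain rfl : x₄ = x₃ + x₂ - x₁ := by linarith
      obtain rfl : y₄ = y₃ + y₂ - y₁ := by linarith
      nlinarith
  have hsmall : (F₃.card : ℝ) ≤ t ^ 2 * (X * Y) := by
    have hle : F₃.card ≤ (Finset.Icc 1 ⌊t * X⌋ ×ˢ Finset.Icc 1 ⌊t * Y⌋).card := by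
      refine Finset.card_le_card_of_injOn
        (fun i => (g (i + 1) - g i, y (g i) - y (g (i + 1)))) ?_ ?_
      · intro i hi
        obtain ⟨hi, h1, h2⟩ := Finset.mem_filter.1 hi
        have hi := Finset.mem_range.1 hi
        have k1 := hgm i (i + 1) (by omega) hi
        have k2 := hstep i hi
        simp only [Finset.coe_product, Finset.coe_Icc, Set.mem_prod, Set.mem_Icc, Int.le_floor]
        push_cast
        exact ⟨⟨by omega, h1⟩, by omega, h2⟩
      · intro i hi j hj hij
        have hi := Finset.mem_range.1 (Finset.mem_filter.1 hi).1
        have hj := Finset.mem_range.1 (Finset.mem_filter.1 hj).1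
        simp only [Prod.mk.injEq] at hij
        by_contra hne
        rcases lt_or_gt_of_ne hne with h | h
        · exact hinj i j h hj hij.1 hij.2
        · exact hinj j i h hi hij.1.symm hij.2.symm
    have hfl : ∀ z : ℝ, 0 ≤ z → (((Finset.Icc (1 : ℤ) ⌊z⌋).card : ℕ) : ℝ) ≤ z := by
      intro z hz
      rw [Int.card_Icc, add_sub_cancel_right]
      have : ((⌊z⌋.toNat : ℤ) : ℝ) = ⌊z⌋ := by rw [Int.toNat_of_nonneg (Int.floor_nonneg.2 hz)]
      rw [← Int.cast_natCast, this]
      exact Int.floor_le z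
    calc (F₃.card : ℝ) ≤ ((Finset.Icc 1 ⌊t * X⌋ ×ˢ Finset.Icc 1 ⌊t * Y⌋).card : ℝ) := by
          exact_mod_cast hle
      _ = ((Finset.Icc 1 ⌊t * X⌋).card : ℝ) * ((Finset.Icc 1 ⌊t * Y⌋).card : ℝ) := by
          rw [Finset.card_product]; push_cast; rfl
      _ ≤ (t * X) * (t * Y) := by
          gcongr
          · exact hfl _ (by positivity)
          · exact hfl _ (by positivity)
      _ = _ := by ring
  have hn' : (n : ℝ) ≤ F₁.card + (F₂.card + F₃.card) := by
    have := (Finset.card_le_card hsub).trans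
      ((Finset.card_union_le _ _).trans (add_le_add_right (Finset.card_union_le _ _) _))
    rw [Finset.card_range] at this
    exact_mod_cast this
  rw [hn]
  push_cast
  have : 2 / t = 1 / t + 1 / t := by ring
  linarith

/-- A vertex is determined by its abscissa: N ≤ ab and a(b - 1) < N leave one integer b. -/
theorem exists_vertex_enumeration {N : ℕ} (hN : 0 < N) :
    ∃ (A : Finset ℤ) (y : ℤ → ℤ),
      (∀ a ∈ A, 0 < a ∧ a ≤ N ∧ 0 < y a ∧ (N : ℤ) ≤ a * y a ∧ a * (y a - 1) < N ∧
        (((a : ℝ), (y a : ℝ)) : ℝ × ℝ) ∈ vertexSet (integerHull (hyperbolaRegion N))) ∧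
      vertexSet (integerHull (hyperbolaRegion N)) =
        ((A.image fun a : ℤ => (((a : ℝ), (y a : ℝ)) : ℝ × ℝ) : Finset (ℝ × ℝ)) : Set (ℝ × ℝ)) := by
  classical
  set V := vertexSet (integerHull (hyperbolaRegion N)) with hV
  let A := (Finset.Icc (1 : ℤ) N).filter (fun a : ℤ => ∃ b : ℤ, (((a : ℝ), (b : ℝ)) : ℝ × ℝ) ∈ V)
  have hex : ∀ a ∈ A, ∃ b : ℤ, (((a : ℝ), (b : ℝ)) : ℝ × ℝ) ∈ V :=
    fun a ha => (Finset.mem_filter.1 ha).2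
  choose! y hy using hex
  have hfacts : ∀ a b : ℤ, (((a : ℝ), (b : ℝ)) : ℝ × ℝ) ∈ V →
      0 < a ∧ a ≤ N ∧ 0 < b ∧ (N : ℤ) ≤ a * b ∧ a * (b - 1) < N := by
    intro a b hv
    obtain ⟨a', b', he, h1, h2, h3, h4, h5⟩ := vertex_coordinates hN hv
    simp only [Prod.mk.injEq, Int.cast_inj] at he
    obtain ⟨rfl, rfl⟩ := he
    refine ⟨h1, ?_, h2, h3, h5⟩
    nlinarith
  refine ⟨A, y, ?_, ?_⟩
  · intro a ha
    obtain ⟨h1, h2, h3, h4, h5⟩ := hfacts a (y a) (hy a ha)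
    exact ⟨h1, h2, h3, h4, h5, hy a ha⟩
  · ext v
    simp only [Finset.coe_image, Set.mem_image, Finset.mem_coe]
    constructor
    · intro hv
      obtain ⟨a, b, rfl, -⟩ := vertex_coordinates hN hv
      obtain ⟨h1, h2, h3, h4, h5⟩ := hfacts a b hv
      have haA : a ∈ A := Finset.mem_filter.2 ⟨Finset.mem_Icc.2 ⟨h1, h2⟩, b, hv⟩
      obtain ⟨-, -, k3, k4, k5⟩ := hfacts a (y a) (hy a haA)
      refine ⟨a, haA, ?_⟩
      have l1 : b - 1 < y a := by
        by_contra! hc; nlinarith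
      have l2 : y a - 1 < b := by
        by_contra! hc; nlinarith
      rw [show y a = b by omega]
    · rintro ⟨a, ha, rfl⟩
      exact hy a ha

theorem ncard_vertices_le {N : ℕ} (hN : 2 ≤ N) :
    (vertexSet (integerHull (hyperbolaRegion N))).Finite ∧
      ((vertexSet (integerHull (hyperbolaRegion N))).ncard : ℝ) ≤
        16 * ((N : ℝ) ^ (1 / 3 : ℝ) * Real.log N) := by
  obtain ⟨A, y, hA, hV⟩ := exists_vertex_enumeration (N := N) (by omega)
  refine ⟨by rw [hV]; exact Finset.finite_toSet _, ?_⟩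
  have hcard : (vertexSet (integerHull (hyperbolaRegion N))).ncard ≤ A.card := by
    rw [hV, Set.ncard_coe_finset]; exact Finset.card_image_le
  have hN0 : (0 : ℝ) < N := by exact_mod_cast (by omega : 0 < N)
  have hN1 : (1 : ℝ) ≤ N := by exact_mod_cast (by omega : 1 ≤ N)
  have hanti : ∀ a ∈ A, ∀ b ∈ A, a < b → y b < y a := by
    intro a ha b hb hab
    obtain ⟨h1, h2, h3, h4, h5, h6⟩ := hA a ha
    obtain ⟨k1, k2, k3, k4, k5, k6⟩ := hA b hb
    by_contra! hc
    rcases hc.eq_or_lt with h | h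
    · rw [← h] at k6
      -- Two vertices at equal height are excluded by a third hull point to their right at that
      -- height, which need not be a vertex.
      have := vertex_below_chord h6.1 k6
        (mem_hull_of_int (a := b + 1) (b := y a) (by omega) h3 (by nlinarith)) hab (by omega)
      nlinarith
    · nlinarith
  have hconv : ∀ a₁ ∈ A, ∀ a₂ ∈ A, ∀ a₃ ∈ A, a₁ < a₂ → a₂ < a₃ →
      (a₃ - a₁) * y a₂ < (a₃ - a₂) * y a₁ + (a₂ - a₁) * y a₃ := by
    intro a₁ h1 a₂ h2 a₃ h3 h12 h23
    exact vertex_below_chord (hA a₁ h1).2.2.2.2.2.1 (hA a₂ h2).2.2.2.2.2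
      (hA a₃ h3).2.2.2.2.2.1 h12 h23
  set T : ℝ := (N : ℝ) ^ (1 / 3 : ℝ)
  have hT0 : 0 < T := Real.rpow_pos_of_pos hN0 _
  have hT1 : 1 ≤ T := Real.one_le_rpow hN1 (by norm_num)
  have hT3 : T ^ 3 = N := by
    rw [← Real.rpow_natCast, ← Real.rpow_mul hN0.le]; norm_num
  have hblock : ∀ k : ℕ, ((A.filter (fun a => Nat.log 2 a.toNat = k)).card : ℝ) ≤ 4 * T := by
    intro k
    have hmem : ∀ a ∈ A.filter (fun a => Nat.log 2 a.toNat = k),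
        a ∈ A ∧ (2 : ℝ) ^ k ≤ a ∧ (a : ℝ) < 2 * 2 ^ k := by
      intro a ha
      obtain ⟨ha, hk⟩ := Finset.mem_filter.1 ha
      have h0 := (hA a ha).1
      lift a to ℕ using h0.le
      rw [Int.toNat_natCast] at hk
      have h1 : 2 ^ k ≤ a := by rw [← hk]; exact Nat.pow_log_le_self _ (by omega)
      have h2 : a < 2 ^ (k + 1) := by rw [← hk]; exact Nat.lt_pow_succ_log_self (by norm_num) _
      rw [pow_succ, mul_comm] at h2
      exact ⟨ha, by exact_mod_cast h1, by exact_mod_cast h2⟩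
    have hX : (0 : ℝ) < 2 ^ k := by positivity
    -- The choice t = N^(-1/3) balances 2/t against t²·XY = t²N, giving 1 + 3T ≤ 4T.
    have := card_convex_chain_le (A.filter (fun a => Nat.log 2 a.toNat = k)) y
      (X := 2 ^ k) (Y := N / 2 ^ k) (t := 1 / T) hX (by positivity) (by positivity)
      (fun a ha b hb => hanti a (hmem a ha).1 b (hmem b hb).1)
      (fun a ha b hb c hc => hconv a (hmem a ha).1 b (hmem b hb).1 c (hmem c hc).1)
      (fun a ha b hb => by linarith [(hmem a ha).2.1, (hmem b hb).2.2])
      (fun a ha b hb => by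
        obtain ⟨h1, h2, h3, h4, h5, h6⟩ := hA a (hmem a ha).1
        have k3 := (hA b (hmem b hb).1).2.2.1
        have k3' : (1 : ℝ) ≤ y b := by exact_mod_cast k3
        have h3' : (0 : ℝ) ≤ (y a : ℝ) - 1 := by rw [sub_nonneg]; exact_mod_cast h3
        have h5' : (a : ℝ) * (y a - 1) < N := by exact_mod_cast h5
        rw [le_div_iff₀ hX]
        nlinarith [mul_le_mul_of_nonneg_right (hmem a ha).2.1 h3'])
    have e1 : 2 / (1 / T) = 2 * T := by field_simp
    have e2 : (1 / T) ^ 2 * ((2 : ℝ) ^ k * (N / 2 ^ k)) = T := by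
      rw [← hT3]; field_simp
    rw [e1, e2] at this
    linarith
  have hmaps : ∀ a ∈ A, Nat.log 2 a.toNat ∈ Finset.range (Nat.log 2 N + 1) := by
    intro a ha
    rw [Finset.mem_range, Nat.lt_succ_iff]
    exact Nat.log_mono_right (by have := (hA a ha).2.1; omega)
  have htotal : (A.card : ℝ) ≤ (Nat.log 2 N + 1) * (4 * T) := by
    rw [Finset.card_eq_sum_card_fiberwise hmaps]
    push_cast
    refine (Finset.sum_le_sum fun k _ => hblock k).trans ?_
    simp
  have hlog : ((Nat.log 2 N : ℕ) : ℝ) + 1 ≤ 4 * Real.log N := by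
    have h1 : ((2 ^ Nat.log 2 N : ℕ) : ℝ) ≤ N := by
      exact_mod_cast Nat.pow_log_le_self 2 (by omega)
    push_cast at h1
    have h2 := Real.log_le_log (by positivity) h1
    rw [Real.log_pow] at h2
    have h3 : Real.log 2 ≤ Real.log N := Real.log_le_log (by norm_num) (by exact_mod_cast hN)
    have h4 := Real.log_two_gt_d9
    have h5 : (0 : ℝ) ≤ (Nat.log 2 N : ℕ) := by positivity
    nlinarith
  calc ((vertexSet (integerHull (hyperbolaRegion N))).ncard : ℝ) ≤ A.card := by exact_mod_cast hcard
    _ ≤ (Nat.log 2 N + 1) * (4 * T) := htotal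
    _ ≤ (4 * Real.log N) * (4 * T) := by gcongr
    _ = 16 * (T * Real.log N) := by ring

/-- The number of vertices of the integer hull of `{(x, y) : x y ≥ N, x, y > 0}` is finite and of
exact order `N ^ (1/3) * log N`, with absolute constants, uniformly in `N ≥ 2`. -/
theorem theorem1 :
    ∃ c C : ℝ, 0 < c ∧ 0 < C ∧ ∀ N : ℕ, 2 ≤ N →
      (vertexSet (integerHull (hyperbolaRegion N))).Finite ∧
      c * ((N : ℝ) ^ (1 / 3 : ℝ) * Real.log N) ≤
        ((vertexSet (integerHull (hyperbolaRegion N))).ncard : ℝ) ∧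
      ((vertexSet (integerHull (hyperbolaRegion N))).ncard : ℝ) ≤
        C * ((N : ℝ) ^ (1 / 3 : ℝ) * Real.log N) := by
  refine ⟨1 / 76032, 16, by norm_num, by norm_num, fun N hN => ?_⟩
  obtain ⟨hfin, hup⟩ := ncard_vertices_le hN
  refine ⟨hfin, ?_, hup⟩
  have := ncard_vertices_ge hN hfin
  linarith
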